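/- All digraphs are finite, have at least one vertex, and have no loops and no parallel arcs (opposite arcs $uv$, $vu$ are allowed); $\delta^+(D)$ is the minimum out-degree of $D$. A \emph{subdivision} of a digraph $F$ is obtained by replacing each arc $uv$ of $F$ by a directed path from $u$ to $v$ of length at least $1$, these paths being internally disjoint from each other and from $V(F)$; $D$ contains it if it is a (not necessarily induced) subdigraph of $D$, up to isomorphism. An \emph{in-arborescence} is an orientation of a tree in which all arcs are directed towards a vertex called the root. For $\ell\ge 1$, $B(0,\ell)$ is a single vertex (root and leaf), and $B(k,\ell)$ is obtained from $B(k-1,\ell)$ by adding, for each leaf $x$ of $B(k-1,\ell)$, $\ell$ new vertices each with an arc to $x$; the leaves of $B(k,\ell)$ are the new vertices. Let $b(k,\ell)=\sum_{i=0}^{k}\ell^i$ be its number of vertices. For $\ell\ge 2$ define recursively $f(1,\ell)=\ell$ and, for $k\ge 2$, $$t(k,\ell)=f\bigl(k-1,\; b(k-1,\ell)(\ell-1)+1\bigr)\cdot b(k-1,\ell),\qquad f(k,\ell)=t(k,\ell)\,(\ell-1)\,k+t(k,\ell).$$ \textbf{Theorem.} Let $k\ge 1$ and $\ell\ge 2$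 be integers. Every digraph $D$ with $\delta^+(D)\ge f(k,\ell)$ contains a subdivision of $B(k,\ell)$. Moreover, every in-arborescence $T$ is $\delta^+$-maderian: there is a least integer $m\ge 0$ such that every digraph $D$ with $\delta^+(D)\ge m$ contains a subdivision of $T$. -/

import Mathlib

universe u v

namespace Digraph

/-- No vertex is adjacent to itself.  A `Digraph` is a relation, so parallel arcs never occur;
opposite arcs `u → v`, `v → u` are allowed. -/
def Loopless {V : Type*} (D : Digraph V) : Prop :=
  ∀ v, ¬ D.Adj v v

/-- The out-degree of a vertex (used for finite digraphs only). -/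
noncomputable def outDegree {V : Type*} (D : Digraph V) (v : V) : ℕ :=
  {w | D.Adj v w}.ncard

/-- The minimum out-degree `δ⁺(D)` (used for nonempty finite digraphs only). -/
noncomputable def minOutDegree {V : Type*} (D : Digraph V) : ℕ :=
  ⨅ v, D.outDegree v

/-- A subdivision of `F` that is a subdigraph of `D`: the vertices of `F` are sent to distinct
(branch) vertices of `D`, and each arc `u → v` of `F` is replaced by a directed path of `D` from
the image of `u` to the image of `v`; the list `interior u v` holds the internal vertices of this
path in order (it is empty when the arc is not subdivided).  The internal vertices are not branch
vertices, and paths replacing different arcs share no internal vertex. -/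
structure SubdivisionIn {U V : Type*} (F : Digraph U) (D : Digraph V) where
  branch : U → V
  interior : U → U → List V
  branch_injective : Function.Injective branch
  isChain : ∀ u v, F.Adj u v →
    List.IsChain D.Adj (branch u :: (interior u v ++ [branch v]))
  nodup : ∀ u v, F.Adj u v → (interior u v).Nodup
  branch_notMem : ∀ u v, F.Adj u v → ∀ w, branch w ∉ interior u v
  disjoint : ∀ u v u' v', F.Adj u v → F.Adj u' v' → (u, v) ≠ (u', v') →
    List.Disjoint (interior u v) (interior u' v')

/-- `D` contains a subdivision of `F` (as a subdigraph, not necessarily induced). -/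
def ContainsSubdivision {U V : Type*} (D : Digraph V) (F : Digraph U) : Prop :=
  Nonempty (SubdivisionIn F D)

/-- `F` is `δ⁺`-maderian: there is a least integer `m` such that every (finite, nonempty,
loopless) digraph of minimum out-degree at least `m` contains a subdivision of `F`. -/
def IsOutMaderian {U : Type v} (F : Digraph U) : Prop :=
  ∃ m : ℕ, IsLeast
    {m : ℕ | ∀ (V : Type u) [Finite V] [Nonempty V] (D : Digraph V), D.Loopless →
      m ≤ D.minOutDegree → D.ContainsSubdivision F} m

/-- An oriented tree: an orientation of an undirected tree, i.e. at most one of `u → v`, `v → u`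
is present and the underlying undirected graph is a tree. -/
def IsOrientedTree {V : Type*} (T : Digraph V) : Prop :=
  (∀ u v, T.Adj u v → ¬ T.Adj v u) ∧ T.toSimpleGraphInclusive.IsTree

/-- An in-arborescence: an oriented tree with a vertex `r` (the root) towards which all arcs are
directed, i.e. the head of each arc is closer to `r` than its tail in the underlying tree. -/
def IsInArborescence {V : Type*} (T : Digraph V) : Prop :=
  T.IsOrientedTree ∧ ∃ r, ∀ u v, T.Adj u v →
    T.toSimpleGraphInclusive.dist v r < T.toSimpleGraphInclusive.dist u r

end Digraph

/-- The vertices of `B(k, ℓ)`: words of length at most `k` over an alphabet of `ℓ` letters.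
The root is the empty word and the leaves are the words of length `k`. -/
abbrev InBranchingVertex (k ℓ : ℕ) : Type :=
  {w : List (Fin ℓ) // w.length ≤ k}

/-- The `ℓ`-branching in-arborescence `B(k, ℓ)` of depth `k`.  Each word `w` of length less than
`k` is dominated by exactly the `ℓ` words `a :: w`; so `B(0, ℓ)` is a single vertex and
`B(k + 1, ℓ)` arises from `B(k, ℓ)` by adding `ℓ` new in-neighbours to each leaf. -/
def inBranching (k ℓ : ℕ) : Digraph (InBranchingVertex k ℓ) where
  Adj u v := ∃ a : Fin ℓ, u.1 = a :: v.1

/-- `b(k, ℓ) = 1 + ℓ + ⋯ + ℓ ^ k`, the number of vertices of `B(k, ℓ)`. -/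
def inBranchingCard (k ℓ : ℕ) : ℕ :=
  ∑ i ∈ Finset.range (k + 1), ℓ ^ i

theorem card_inBranchingVertex (k ℓ : ℕ) :
    Nat.card (InBranchingVertex k ℓ) = inBranchingCard k ℓ := by
  let e : InBranchingVertex k ℓ ≃ (i : Fin (k + 1)) × List.Vector (Fin ℓ) i :=
    { toFun := fun w => ⟨⟨w.1.length, Nat.lt_succ_of_le w.2⟩, ⟨w.1, rfl⟩⟩
      invFun := fun p => ⟨p.2.1, by have h := p.2.2; have h2 := p.1.2; omega⟩
      left_inv := fun w => rfl
      right_inv := by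
        rintro ⟨⟨i, hi⟩, ⟨l, hl⟩⟩
        simp only at hl
        subst hl
        rfl }
  rw [Nat.card_congr e, Nat.card_eq_fintype_card, Fintype.card_sigma, inBranchingCard,
    Finset.sum_range]
  simp [card_vector]

/-- The recursive bound `f(k, ℓ)`, for `k ≥ 1` and `ℓ ≥ 2`: `f(1, ℓ) = ℓ` and, for `k ≥ 2`,
`f(k, ℓ) = t(k, ℓ) (ℓ - 1) k + t(k, ℓ)`, where
`t(k, ℓ) = f(k - 1, b(k - 1, ℓ) (ℓ - 1) + 1) b(k - 1, ℓ)`.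
The value at `k = 0` is a placeholder that the recursion never uses. -/
def inBranchingBound : ℕ → ℕ → ℕ
  | 0, _ => 0
  | 1, ℓ => ℓ
  | k + 2, ℓ =>
    let b := inBranchingCard (k + 1) ℓ
    let t := inBranchingBound (k + 1) (b * (ℓ - 1) + 1) * b
    t * (ℓ - 1) * (k + 2) + t

/-! Induction on the depth `k`, for all `ℓ` at once. Suppose that `D` contains no subdivision of
`B(k, ℓ)`. Choose disjoint copies of `B(k-1, ℓ)`, ..., `B(1, ℓ)` greedily, deepest first. By
maximality, a leftover vertex has at most `ℓ - 1` in-neighbours among the roots of each depth, and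
at most `ℓ - 1` among the leftover vertices (copies of depth 0), so at most `d = (ℓ - 1) k` in all
(`exists_packing`).

Hall's theorem then matches every root or leftover vertex with at least `d` leftover out-neighbours
to a private one (`exists_injective_adj`). Following the matching from each root gives disjoint
paths, each ending at an exit with fewer than `d` leftover out-neighbours. The other out-neighbours
of an exit lie in the copies, which have at most `b = b(k-1, ℓ)` vertices each. So contracting every
copy with its path leaves a digraph of large minimum out-degree, which by induction contains a
subdivision of `B(k-1, b(ℓ-1)+1)`.

This lifts to `D` (`PlantedBranching.lift`). Among `b(ℓ-1)+1` arcs entering a copy, `ℓ` share their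
head, which becomes the new branch vertex and is joined to the exit through the copy. A leaf is
replaced by a copy of `B(1, ℓ)` inside its own copy, which supplies the missing level.

For a general in-arborescence it suffices to embed it in some `B(k, ℓ)`. -/

theorem Set.exists_injective_fin_of_le_ncard {α : Type*} {s : Set α} {n : ℕ} (hs : s.Finite)
    (h : n ≤ s.ncard) : ∃ g : Fin n → α, Function.Injective g ∧ ∀ i, g i ∈ s := by
  obtain ⟨t, hts, ht⟩ := Set.exists_subset_card_eq h
  have htf : t.Finite := hs.subset hts
  have : Finite t := htf
  have e : t ≃ Fin n := (Finite.equivFinOfCardEq (by rw [← ht]; rfl))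
  exact ⟨fun i => (e.symm i).1, fun i j hij => e.symm.injective (Subtype.ext hij),
    fun i => hts (e.symm i).2⟩

/-! ### Paths recorded by their vertex sets, and paths along an injective relation. -/

/-- `SimplePath A u v S`: there is a path from `u` to `v` along `A` with vertex set `S`. -/
inductive SimplePath {V : Type*} (A : V → V → Prop) (u : V) : V → Set V → Prop
  | refl : SimplePath A u u {u}
  | step {v w : V} {S : Set V} : SimplePath A u v S → A v w → w ∉ S →
      SimplePath A u w (insert w S)

namespace SimplePath

variable {V : Type*} {A B : V → V → Prop} {u v w : V} {S T : Set V}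

theorem left_mem (h : SimplePath A u v S) : u ∈ S := by
  induction h with
  | refl => exact rfl
  | step _ _ _ ih => exact Or.inr ih

theorem right_mem (h : SimplePath A u v S) : v ∈ S := by
  cases h with
  | refl => exact rfl
  | step => exact Or.inl rfl

theorem mono (hAB : ∀ x y, A x y → B x y) (h : SimplePath A u v S) : SimplePath B u v S := by
  induction h with
  | refl => exact .refl
  | step _ ha hn ih => exact .step ih (hAB _ _ ha) hn

theorem trans (h : SimplePath A u v S) (h' : SimplePath A v w T) (hST : S ∩ T ⊆ {v}) :
    SimplePath A u w (S ∪ T) := by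
  induction h' with
  | refl => rwa [Set.union_eq_self_of_subset_right (by simpa using h.right_mem)]
  | @step x y T hp ha hn ih =>
    rw [Set.union_insert]
    refine .step (ih fun z hz => hST ⟨hz.1, Or.inr hz.2⟩) ha ?_
    rintro (hy | hy)
    · have : y = v := hST ⟨hy, Or.inl rfl⟩
      exact hn (this ▸ hp.left_mem)
    · exact hn hy

theorem reflTransGen (h : SimplePath A u v S) : ∀ x ∈ S, Relation.ReflTransGen A u x := by
  induction h with
  | refl => rintro x rfl; exact .refl
  | step hp ha _ ih =>
    rintro x (rfl | hx)
    · exact (ih _ hp.right_mem).tail ha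
    · exact ih _ hx

/-- The condition `x ≠ v` is the point: if `A` is injective, an arc leaving the end `v` cannot
return to the path, except to its start. -/
theorem eq_or_exists_pred (h : SimplePath A u v S) :
    ∀ y ∈ S, y = u ∨ ∃ x ∈ S, x ≠ v ∧ A x y := by
  induction h with
  | refl => rintro x rfl; exact Or.inl rfl
  | @step v w S hp ha hn ih =>
    rintro y (rfl | hy)
    · exact Or.inr ⟨v, Or.inr hp.right_mem, fun h => hn (h ▸ hp.right_mem), ha⟩
    · refine (ih y hy).imp_right ?_
      rintro ⟨x, hx, -, hxy⟩
      exact ⟨x, Or.inr hx, fun h => hn (h ▸ hx), hxy⟩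

/-- Along an injective relation, a path starting at a vertex without predecessor can be
continued to a vertex without successor. -/
theorem exists_forall_not [Finite V] (hA : ∀ x y z, A x z → A y z → x = y) (u : V)
    (hu : ∀ x, ¬ A x u) : ∃ v S, SimplePath A u v S ∧ ∀ w, ¬ A v w := by
  obtain ⟨S, ⟨v, hv⟩, hmax⟩ := (Set.toFinite {S : Set V | ∃ v, SimplePath A u v S}).exists_maximal
    ⟨_, u, .refl⟩
  refine ⟨v, S, hv, fun w hw => ?_⟩
  by_cases hwS : w ∈ S
  · rcases hv.eq_or_exists_pred w hwS with rfl | ⟨x, -, hxv, hxw⟩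
    · exact hu v hw
    · exact hxv (hA _ _ _ hxw hw)
  · exact hwS (hmax ⟨w, hv.step hw hwS⟩ (Set.subset_insert _ _) (Or.inl rfl))

end SimplePath

/-- Walking backwards along an injective relation is deterministic, so a vertex is reached from at
most one source. This makes the paths from different roots disjoint. -/
theorem Relation.ReflTransGen.eq_of_forall_not {V : Type*} {A : V → V → Prop}
    (hA : ∀ x y z, A x z → A y z → x = y) {u u' v : V} (hu : ∀ x, ¬ A x u)
    (hu' : ∀ x, ¬ A x u') (h : Relation.ReflTransGen A u v)
    (h' : Relation.ReflTransGen A u' v) : u = u' := by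
  induction h with
  | refl =>
    rcases h'.cases_tail with h | ⟨x, -, hx⟩
    · exact h
    · exact (hu x hx).elim
  | tail _ ha ih =>
    rcases h'.cases_tail with rfl | ⟨x, hx, hxa⟩
    · exact (hu' _ ha).elim
    · exact ih (hA _ _ _ hxa ha ▸ hx)

/-! ### Planted branchings and their lifting from a contracted digraph. -/

namespace Digraph

variable {V : Type*}

/-- `D.PlantedBranching ℓ k v S`: the set `S` is the vertex set of a subdivision of `B(k, ℓ)` in
`D` together with a path from its root to `v` that meets the subdivision in the root only. -/
inductive PlantedBranching (D : Digraph V) (ℓ : ℕ) : ℕ → V → Set V → Prop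
  | single (v : V) : PlantedBranching D ℓ 0 v {v}
  | step {k : ℕ} {v w : V} {S : Set V} : PlantedBranching D ℓ k v S → D.Adj v w → w ∉ S →
      PlantedBranching D ℓ k w (insert w S)
  | branch {k : ℕ} {r : V} {v : Fin ℓ → V} {S : Fin ℓ → Set V} :
      (∀ i, PlantedBranching D ℓ k (v i) (S i)) → Pairwise (fun i j => Disjoint (S i) (S j)) →
      (∀ i, D.Adj (v i) r) → (∀ i, r ∉ S i) → PlantedBranching D ℓ (k + 1) r (insert r (⋃ i, S i))

namespace PlantedBranching

variable {D : Digraph V} {ℓ k : ℕ} {v w : V} {S T : Set V}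

theorem mem (h : D.PlantedBranching ℓ k v S) : v ∈ S := by
  cases h with
  | single => exact rfl
  | step => exact Or.inl rfl
  | branch => exact Or.inl rfl

theorem extend (h : D.PlantedBranching ℓ k v S) (hp : SimplePath D.Adj v w T)
    (hST : S ∩ T ⊆ {v}) : D.PlantedBranching ℓ k w (S ∪ T) := by
  induction hp with
  | refl => rwa [Set.union_eq_self_of_subset_right (by simpa using h.mem)]
  | @step x y T hp ha hn ih =>
    rw [Set.union_insert]
    refine .step (ih fun z hz => hST ⟨hz.1, Or.inr hz.2⟩) ha ?_
    rintro (hy | hy)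
    · have : y = v := hST ⟨hy, Or.inl rfl⟩
      exact hn (this ▸ hp.left_mem)
    · exact hn hy

theorem exists_simplePath (h : D.PlantedBranching ℓ k v S) :
    ∀ u ∈ S, ∃ T ⊆ S, SimplePath D.Adj u v T := by
  induction h with
  | single v => rintro u rfl; exact ⟨_, subset_rfl, .refl⟩
  | step hp ha hn ih =>
    rintro u (rfl | hu)
    · exact ⟨_, by simp, .refl⟩
    · obtain ⟨T, hT, hp⟩ := ih u hu
      exact ⟨_, Set.insert_subset_insert hT, hp.step ha fun h => hn (hT h)⟩
  | branch hp hd ha hn ih =>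
    rintro u (rfl | hu)
    · exact ⟨_, by simp, .refl⟩
    · obtain ⟨i, hi⟩ := Set.mem_iUnion.1 hu
      obtain ⟨T, hT, hp⟩ := ih i u hi
      exact ⟨_, Set.insert_subset_insert (hT.trans (Set.subset_iUnion _ i)),
        hp.step (ha i) fun h => hn i (hT h)⟩

/-- Cut off the lowest level; the path above the root is kept, so the end `v` does not change. -/
theorem pred : ∀ {k : ℕ} {v : V} {S : Set V}, D.PlantedBranching ℓ (k + 1) v S →
    ∃ T ⊆ S, D.PlantedBranching ℓ k v T := by
  intro k v S h
  generalize hm : k + 1 = m at h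
  induction h generalizing k with
  | single => omega
  | step hp ha hn ih =>
    obtain ⟨T, hT, h⟩ := ih hm
    exact ⟨_, Set.insert_subset_insert hT, h.step ha fun h => hn (hT h)⟩
  | @branch m r v S hp hd ha hn ih =>
    cases k with
    | zero => exact ⟨{r}, by simp, .single r⟩
    | succ k =>
      choose T hT h using fun i => ih i (k := k) (by omega)
      exact ⟨_, Set.insert_subset_insert (Set.iUnion_mono hT), .branch h
        (fun i j hij => (hd hij).mono (hT i) (hT j)) ha fun i hi => hn i (hT i hi)⟩

theorem of_le {j : ℕ} (hjk : j ≤ k) (h : D.PlantedBranching ℓ k v S) :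
    ∃ T ⊆ S, D.PlantedBranching ℓ j v T := by
  induction k, hjk using Nat.le_induction generalizing S with
  | base => exact ⟨S, subset_rfl, h⟩
  | succ k _ ih =>
    obtain ⟨T, hT, h⟩ := h.pred
    obtain ⟨T', hT', h⟩ := ih h
    exact ⟨T', hT'.trans hT, h⟩

/-- Branchings of a contracted digraph `D'` lift to `D`.  Every vertex `y` of `D'` stands for a
territory of `D`, which is entered through at most `b` vertices, is left through `a y`, and
contains itself a branching of depth one. -/
theorem lift {W : Type*} {D' : Digraph W} {b j : ℕ} {y : W} {S : Set W} {a : W → V}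
    {entry terr : W → Set V} (hfin : ∀ y, (entry y).Finite) (hcard : ∀ y, (entry y).ncard ≤ b)
    (hℓ : 1 ≤ ℓ)
    (hdisj : Pairwise (fun y z => Disjoint (terr y) (terr z)))
    (hpath : ∀ y, ∀ u ∈ entry y, ∃ T ⊆ terr y, SimplePath D.Adj u (a y) T)
    (hbase : ∀ y, ∃ T ⊆ terr y, D.PlantedBranching ℓ 1 (a y) T)
    (hadj : ∀ y z, D'.Adj y z → ∃ u ∈ entry z, D.Adj (a y) u)
    (h : D'.PlantedBranching (b * (ℓ - 1) + 1) j y S) :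
    ∃ T ⊆ ⋃ z ∈ S, terr z, D.PlantedBranching ℓ (j + 1) (a y) T := by
  have key : ∀ (y : W) (S : Set W), y ∉ S → Disjoint (⋃ z ∈ S, terr z) (terr y) := by
    intro y S hy
    simp only [Set.disjoint_iUnion_left]
    exact fun z hz => hdisj fun h => hy (h ▸ hz)
  induction h with
  | single y =>
    -- The extra level of depth is gained here: a leaf of the contracted branching becomes a
    -- branching of depth one.
    obtain ⟨T, hT, h⟩ := hbase y
    exact ⟨T, by simpa using hT, h⟩
  | @step j v w S hp ha hn ih =>
    obtain ⟨T, hT, h⟩ := ih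
    obtain ⟨u, hu, hau⟩ := hadj v w ha
    obtain ⟨T', hT', hp'⟩ := hpath w u hu
    have hd : Disjoint T T' := (key w S hn).mono hT hT'
    refine ⟨insert u T ∪ T', ?_, (h.step hau ?_).extend hp' ?_⟩
    · rw [Set.biUnion_insert]
      exact Set.union_subset (Set.insert_subset (Or.inl (hT' hp'.left_mem))
        (hT.trans Set.subset_union_right)) (hT'.trans Set.subset_union_left)
    · exact fun hu => Set.disjoint_left.1 hd hu hp'.left_mem
    · rintro x ⟨rfl | hx, hx'⟩
      · rfl
      · exact (Set.disjoint_left.1 hd hx hx').elim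
  | @branch j r v S hp hd ha hn ih =>
    choose T hT h using ih
    choose u hu hau using fun i => hadj (v i) r (ha i)
    classical
    -- Pigeonhole: `b (ℓ - 1) + 1` arcs enter through at most `b` vertices, so at least `ℓ` of them
    -- have the same head `x`. This `x` is the new branch vertex, and `T'` leads from it to the exit
    -- `a r`.
    obtain ⟨x, hx, hlt⟩ := Finset.exists_lt_card_fiber_of_mul_lt_card_of_maps_to
      (s := Finset.univ) (t := (hfin r).toFinset) (f := u) (n := ℓ - 1)
      (fun i _ => by simpa using hu i) (by
        rw [Finset.card_univ, Fintype.card_fin, ← Set.ncard_eq_toFinset_card _ (hfin r)]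
        exact Nat.lt_succ_of_le (Nat.mul_le_mul_right _ (hcard r)))
    obtain ⟨g, hg, hgx⟩ := Set.exists_injective_fin_of_le_ncard (n := ℓ)
      (s := {i | u i = x}) (Set.toFinite _) (by
        rw [Set.ncard_eq_toFinset_card']
        simp only [Set.toFinset_ofPred]
        omega)
    obtain ⟨T', hT', hp'⟩ := hpath r x (by simpa using hx)
    have hdT : ∀ i, Disjoint (T i) T' := fun i => (key r (S i) (hn i)).mono (hT i) hT'
    have hdS : ∀ i j, i ≠ j → Disjoint (T i) (T j) := by
      intro i j hij
      refine Disjoint.mono (hT i) (hT j) ?_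
      simp only [Set.disjoint_iUnion_left, Set.disjoint_iUnion_right]
      exact fun z hz z' hz' => hdisj fun h => Set.disjoint_left.1 (hd hij) (h ▸ hz') hz
    refine ⟨insert x (⋃ i, T (g i)) ∪ T', ?_, (branch (fun i => h (g i))
      (fun i j hij => hdS _ _ fun h => hij (hg h)) (fun i => ?_) fun i hi => ?_).extend hp' ?_⟩
    · rw [Set.biUnion_insert]
      refine Set.union_subset (Set.insert_subset (Or.inl (hT' hp'.left_mem))
        (Set.iUnion_subset fun i => (hT _).trans ?_)) (hT'.trans Set.subset_union_left)
      exact (Set.biUnion_subset_biUnion_left (Set.subset_iUnion S (g i))).trans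
        Set.subset_union_right
    · have := hau (g i)
      rwa [hgx i] at this
    · exact Set.disjoint_left.1 (hdT _) hi hp'.left_mem
    · rintro z ⟨rfl | hz, hz'⟩
      · rfl
      · obtain ⟨i, hi⟩ := Set.mem_iUnion.1 hz
        exact (Set.disjoint_left.1 (hdT _) hi hz').elim

end PlantedBranching

end Digraph

/-! ### Elementary properties of the numbers `b(k, ℓ)` and `f(k, ℓ)`. -/

theorem inBranchingCard_succ (k ℓ : ℕ) :
    inBranchingCard (k + 1) ℓ = ℓ * inBranchingCard k ℓ + 1 :=
  geom_sum_succ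

theorem inBranchingCard_mono {i j ℓ : ℕ} (h : i ≤ j) :
    inBranchingCard i ℓ ≤ inBranchingCard j ℓ :=
  Finset.sum_le_sum_of_subset (Finset.range_mono (by omega))

theorem inBranchingCard_pos (k ℓ : ℕ) : 0 < inBranchingCard k ℓ := by
  have := inBranchingCard_mono (ℓ := ℓ) (Nat.zero_le k)
  simp only [inBranchingCard, Nat.reduceAdd, Finset.range_one, Finset.sum_singleton,
    pow_zero] at this
  exact this

theorem inBranchingBound_pos (k : ℕ) {ℓ : ℕ} (hℓ : 0 < ℓ) : 0 < inBranchingBound (k + 1) ℓ := by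
  induction k generalizing ℓ with
  | zero => exact hℓ
  | succ k ih =>
    simp only [inBranchingBound]
    exact Nat.add_pos_right _ (Nat.mul_pos (ih (Nat.succ_pos _)) (inBranchingCard_pos _ _))

/-! ### Packing, matching, contraction, and the induction on depth. -/

namespace Digraph

variable {V : Type*} {D : Digraph V} {ℓ : ℕ}

theorem minOutDegree_le (D : Digraph V) (v : V) : D.minOutDegree ≤ D.outDegree v :=
  ciInf_le (OrderBot.bddBelow _) v

theorem le_minOutDegree [Nonempty V] {m : ℕ} (h : ∀ v, m ≤ D.outDegree v) :
    m ≤ D.minOutDegree :=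
  le_ciInf h

/-- In-degrees and out-degrees have the same average. -/
theorem exists_le_ncard_inNeighbors [Finite V] [Nonempty V] {m : ℕ}
    (h : ∀ v, m ≤ D.outDegree v) : ∃ v, m ≤ {x | D.Adj x v}.ncard := by
  classical
  have := Fintype.ofFinite V
  by_contra! hlt
  rcases m with - | m
  · exact absurd (hlt (Classical.arbitrary V)) (Nat.not_lt_zero _)
  have key := Finset.card_mul_le_card_mul (s := Finset.univ) (t := Finset.univ) D.Adj
    (m := m + 1) (n := m)
    (fun v _ => by
      refine (h v).trans (le_of_eq ?_)
      rw [outDegree, Set.ncard_eq_toFinset_card']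
      congr 1; ext; simp)
    (fun v _ => by
      refine le_trans (le_of_eq ?_) (Nat.le_of_lt_succ (hlt v))
      rw [Set.ncard_eq_toFinset_card']
      congr 1; ext; simp)
  exact absurd (Nat.le_of_mul_le_mul_left key (Finset.card_pos.2 Finset.univ_nonempty)) (by omega)

/-- A planted branching that is no larger than `B(i, ℓ)`, so that no arc is subdivided. -/
def IsCompactBranching (D : Digraph V) (ℓ i : ℕ) (r : V) (S : Set V) : Prop :=
  D.PlantedBranching ℓ i r S ∧ S.ncard ≤ inBranchingCard i ℓ

theorem isCompactBranching_zero (D : Digraph V) (ℓ : ℕ) (v : V) :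
    D.IsCompactBranching ℓ 0 v {v} :=
  ⟨.single v, by simp [inBranchingCard]⟩

/-- Placing `v` above `ℓ` of the roots keeps the branching compact, since `b(i + 1, ℓ) = ℓ b(i, ℓ) +
1`. Contrapositively, without copies of depth `i + 1`, fewer than `ℓ` roots of depth `i` send an arc
to `v`. -/
theorem exists_isCompactBranching_succ [Finite V] {i : ℕ} {Q : Set (V × Set V)}
    (hQ : ∀ p ∈ Q, D.IsCompactBranching ℓ i p.1 p.2) (hd : Q.PairwiseDisjoint Prod.snd) {v : V}
    (hv : ∀ p ∈ Q, v ∉ p.2) (h : ℓ ≤ {x | D.Adj x v ∧ x ∈ Prod.fst '' Q}.ncard) :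
    ∃ S ⊆ insert v (⋃ p ∈ Q, p.2), D.IsCompactBranching ℓ (i + 1) v S := by
  obtain ⟨g, hg, hgv⟩ := Set.exists_injective_fin_of_le_ncard (Set.toFinite _) h
  choose p hpQ hpg using fun j => (hgv j).2
  refine ⟨insert v (⋃ j, (p j).2), Set.insert_subset_insert (Set.iUnion_subset fun j =>
    Set.subset_biUnion_of_mem (u := Prod.snd) (hpQ j)),
    .branch (v := fun j => (p j).1) (fun j => (hQ _ (hpQ j)).1) (fun j j' hj => ?_)
    (fun j => ?_) fun j => hv _ (hpQ j), ?_⟩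
  · refine hd (hpQ j) (hpQ j') fun h => hj (hg ?_)
    rw [← hpg, ← hpg, h]
  · rw [hpg]
    exact (hgv j).1
  · refine (Set.ncard_insert_le _ _).trans ?_
    rw [inBranchingCard_succ]
    refine Nat.succ_le_succ ((Set.ncard_iUnion_le_of_fintype _).trans ?_)
    refine (Finset.sum_le_card_nsmul _ _ _ fun j _ => (hQ _ (hpQ j)).2).trans ?_
    simp

/-- If `U` contains no copy of `B(i + 1, ℓ)`, then disjoint copies of `B(1, ℓ), …, B(i, ℓ)` can be
packed in `U` such that every remaining vertex has few in-neighbours among the remaining vertices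
and the roots. -/
theorem exists_packing [Finite V] (hD : D.Loopless) (hℓ : 1 ≤ ℓ) (i : ℕ) :
    ∀ U : Set V, (∀ r, ∀ S ⊆ U, ¬ D.IsCompactBranching ℓ (i + 1) r S) →
    ∃ P : Set (V × Set V),
      (∀ p ∈ P, p.2 ⊆ U ∧ ∃ j, 1 ≤ j ∧ j ≤ i ∧ D.IsCompactBranching ℓ j p.1 p.2) ∧
      P.PairwiseDisjoint Prod.snd ∧
      ∀ v ∈ U \ ⋃ p ∈ P, p.2,
        {x | D.Adj x v ∧ (x ∈ U \ ⋃ p ∈ P, p.2 ∨ x ∈ Prod.fst '' P)}.ncard ≤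
          (ℓ - 1) * (i + 1) := by
  induction i with
  | zero =>
    intro U hU
    refine ⟨∅, by simp, by simp, fun v hv => ?_⟩
    by_contra! hlt
    obtain ⟨S, hS, h⟩ := exists_isCompactBranching_succ (D := D) (ℓ := ℓ) (v := v)
      (Q := (fun x => (x, {x})) '' (U \ {v})) (i := 0)
      (by rintro _ ⟨x, -, rfl⟩; exact D.isCompactBranching_zero ℓ x)
      (by
        rintro _ ⟨x, -, rfl⟩ _ ⟨y, -, rfl⟩ hxy
        exact Set.disjoint_singleton.2 fun h : x = y => hxy (by rw [h]))
      (by rintro _ ⟨x, hx, rfl⟩ h; exact hx.2 h.symm)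
      (by
        refine le_trans (Nat.le_of_pred_lt (by simpa using hlt)) (Set.ncard_le_ncard ?_ (Set.toFinite _))
        rintro x ⟨hxv, hx⟩
        refine ⟨hxv, (x, {x}), ⟨x, ⟨?_, ?_⟩, rfl⟩, rfl⟩
        · simpa using hx
        · rintro rfl; exact hD _ hxv)
    refine hU v S (hS.trans (Set.insert_subset hv.1 ?_)) h
    simp only [Set.iUnion_subset_iff]
    rintro _ ⟨x, hx, rfl⟩
    exact Set.singleton_subset_iff.2 hx.1
  | succ i ih =>
    intro U hU
    -- A maximal packing of copies of depth `i + 1`. What it leaves of `U` contains no further such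
    -- copy, so the induction hypothesis applies there; the roots of `Q` add at most `ℓ - 1` to the
    -- in-neighbours counted.
    obtain ⟨Q, ⟨hQ, hQd⟩, hmax⟩ := (Set.toFinite {Q : Set (V × Set V) |
      (∀ p ∈ Q, p.2 ⊆ U ∧ D.IsCompactBranching ℓ (i + 1) p.1 p.2) ∧
        Q.PairwiseDisjoint Prod.snd}).exists_maximal ⟨∅, by simp, by simp⟩
    obtain ⟨P, hP, hPd, hPv⟩ := ih (U \ ⋃ p ∈ Q, p.2) fun r S hS h => by
      have hr : r ∈ S := h.1.mem
      have hrQ : r ∉ ⋃ p ∈ Q, p.2 := (hS hr).2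
      have hmem := hmax (y := insert (r, S) Q) ⟨?_, ?_⟩ (Set.subset_insert _ _) (Or.inl rfl)
      · exact hrQ (Set.mem_biUnion hmem hr)
      · rintro p (rfl | hp)
        · exact ⟨hS.trans Set.sdiff_subset, h⟩
        · exact hQ p hp
      · refine hQd.insert fun p hp _ => ?_
        exact Set.disjoint_left.2 fun x hx hxp => (hS hx).2 (Set.mem_biUnion hp hxp)
    have hU' : U \ ⋃ p ∈ P ∪ Q, p.2 = (U \ ⋃ p ∈ Q, p.2) \ ⋃ p ∈ P, p.2 := by
      rw [Set.biUnion_union, Set.sdiff_sdiff, Set.union_comm]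
    refine ⟨P ∪ Q, ?_, ?_, fun v hv => ?_⟩
    · rintro p (hp | hp)
      · obtain ⟨h, j, h1, hj, hj'⟩ := hP p hp
        exact ⟨h.trans Set.sdiff_subset, j, h1, by omega, hj'⟩
      · exact ⟨(hQ p hp).1, i + 1, by omega, le_rfl, (hQ p hp).2⟩
    · refine hPd.union hQd fun p hp q hq _ => ?_
      exact Set.disjoint_left.2 fun x hx hxq => ((hP p hp).1 hx).2 (Set.mem_biUnion hq hxq)
    · rw [hU'] at hv ⊢
      have hlt : {x | D.Adj x v ∧ x ∈ Prod.fst '' Q}.ncard < ℓ := by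
        by_contra! hle
        obtain ⟨S, hS, h⟩ := exists_isCompactBranching_succ (fun p hp => (hQ p hp).2) hQd
          (fun p hp hvp => hv.1.2 (Set.mem_biUnion hp hvp)) hle
        refine hU v S (hS.trans (Set.insert_subset hv.1.1 ?_)) h
        exact Set.iUnion₂_subset fun p hp => (hQ p hp).1
      refine (Set.ncard_le_ncard (t := {x | D.Adj x v ∧ (x ∈ (U \ ⋃ p ∈ Q, p.2) \ ⋃ p ∈ P, p.2 ∨
        x ∈ Prod.fst '' P)} ∪ {x | D.Adj x v ∧ x ∈ Prod.fst '' Q}) ?_ (Set.toFinite _)).trans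
        ((Set.ncard_union_le _ _).trans ?_)
      · rintro x ⟨hx, h | h⟩
        · exact Or.inl ⟨hx, Or.inl h⟩
        · rw [Set.image_union] at h
          exact h.imp (fun h => ⟨hx, Or.inr h⟩) fun h => ⟨hx, h⟩
      · have := hPv v hv
        rw [Nat.mul_succ]
        omega

/-- A matching form of Hall's theorem: if every vertex of `X` has at least `d ≥ 1` out-neighbours
in `Y`, and every vertex of `Y` has at most `d` in-neighbours in `X`, then `X` can be matched
into `Y`. -/
theorem exists_injective_adj [Finite V] {X Y : Set V} {d : ℕ} (hd : 1 ≤ d)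
    (hX : ∀ x ∈ X, d ≤ {y | D.Adj x y ∧ y ∈ Y}.ncard)
    (hY : ∀ y ∈ Y, {x | D.Adj x y ∧ x ∈ X}.ncard ≤ d) :
    ∃ f : X → V, Function.Injective f ∧ ∀ x : X, D.Adj x (f x) ∧ f x ∈ Y := by
  classical
  have := Fintype.ofFinite V
  obtain ⟨f, hf, hfx⟩ := (Finset.all_card_le_biUnion_card_iff_exists_injective
    fun x : X => ({y | D.Adj x y ∧ y ∈ Y} : Finset V)).1 fun s => by
      -- Hall's condition by double counting the arcs from `s` to its neighbourhood `N` in `Y`: `d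
      -- |s| ≤ e(s, N) ≤ d |N|`.
      refine Nat.le_of_mul_le_mul_right (c := d) ?_ hd
      refine Finset.card_mul_le_card_mul (fun (x : X) y => D.Adj x y) (fun x hx => ?_) fun y hy => ?_
      · refine (hX x x.2).trans ?_
        rw [Set.ncard_eq_toFinset_card']
        refine Finset.card_le_card fun y hy => ?_
        simp only [Set.toFinset_ofPred, Finset.mem_filter_univ] at hy
        simp only [Finset.mem_bipartiteAbove, Finset.mem_biUnion, Finset.mem_filter_univ]
        exact ⟨⟨x, hx, hy⟩, hy.1⟩
      · simp only [Finset.mem_biUnion, Finset.mem_filter_univ] at hy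
        obtain ⟨-, -, -, hyY⟩ := hy
        refine le_trans ?_ (hY y hyY)
        rw [Set.ncard_eq_toFinset_card', ← Finset.card_map (Function.Embedding.subtype _)]
        refine Finset.card_le_card fun x hx => ?_
        simp only [Finset.mem_map, Finset.mem_bipartiteBelow] at hx
        obtain ⟨x, ⟨-, hx⟩, rfl⟩ := hx
        simpa using hx
  exact ⟨f, hf, fun x => by simpa using hfx x⟩

/-- The contraction step: a packing of small branchings of positive depth whose roots, together
with the remaining vertices, send few arcs to each remaining vertex.  Every root has a private path
through the remaining vertices to a vertex with many out-neighbours in the packing. -/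
theorem exists_plantedBranching_of_packing {V : Type u} {D : Digraph V} [Finite V] [Nonempty V]
    {b d s k : ℕ} (hℓ : 1 ≤ ℓ)
    (hb : 1 ≤ b) (hd : 1 ≤ d) {P : Set (V × Set V)}
    (hP : ∀ p ∈ P, p.2.ncard ≤ b ∧ ∃ j, 1 ≤ j ∧ D.PlantedBranching ℓ j p.1 p.2)
    (hPd : P.PairwiseDisjoint Prod.snd)
    (hPv : ∀ v ∉ ⋃ p ∈ P, p.2,
      {x | D.Adj x v ∧ (x ∉ ⋃ p ∈ P, p.2 ∨ x ∈ Prod.fst '' P)}.ncard ≤ d)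
    (hdeg : ∀ v, d + (s + 1) * b ≤ D.outDegree v)
    (ih : ∀ (W : Type u) [Finite W] [Nonempty W] (D' : Digraph W), D'.Loopless →
      s ≤ D'.minOutDegree → ∃ y S, D'.PlantedBranching (b * (ℓ - 1) + 1) k y S) :
    ∃ v S, D.PlantedBranching ℓ (k + 1) v S := by
  set Y : Set V := {v | v ∉ ⋃ p ∈ P, p.2} with hYdef
  have hYP : ∀ p ∈ P, ∀ x ∈ p.2, x ∉ Y := fun p hp x hx h => h (Set.mem_biUnion hp hx)
  have hroot : ∀ p ∈ P, p.1 ∈ p.2 := fun p hp => (hP p hp).2.elim fun j h => h.2.mem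
  -- With an empty packing every in-degree would be at most `d`, below the average.
  have hPne : Nonempty P := by
    by_contra hne
    have hYuniv : ∀ x, x ∈ Y := by
      intro x hx
      simp only [Set.mem_iUnion] at hx
      obtain ⟨p, hp, -⟩ := hx
      exact hne ⟨p, hp⟩
    obtain ⟨v, hv⟩ := exists_le_ncard_inNeighbors hdeg
    have hle : {x | D.Adj x v}.ncard ≤ d :=
      le_trans (Set.ncard_le_ncard (fun x (hx : D.Adj x v) => by
        exact ⟨hx, Or.inl (hYuniv x)⟩) (Set.toFinite _)) (hPv v (hYuniv v))
    have : 1 ≤ (s + 1) * b := Nat.mul_pos (Nat.succ_pos _) hb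
    omega
  let X : Set V := {x | (x ∈ Y ∨ x ∈ Prod.fst '' P) ∧ d ≤ {y | D.Adj x y ∧ y ∈ Y}.ncard}
  obtain ⟨f, hf, hfX⟩ := exists_injective_adj (D := D) (X := X) (Y := Y) hd (fun x hx => hx.2)
    fun y hy => le_trans (Set.ncard_le_ncard (by exact fun x hx => ⟨hx.1, hx.2.1⟩)
      (Set.toFinite _)) (hPv y hy)
  -- The graph of the matching. It is injective with values in `Y`, so roots have no predecessor; a
  -- vertex has no successor exactly when it lies outside `X`.
  let A : V → V → Prop := fun x y => ∃ h : x ∈ X, f ⟨x, h⟩ = y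
  have hAinj : ∀ x y z, A x z → A y z → x = y := by
    rintro x y z ⟨hx, rfl⟩ ⟨hy, hxy⟩
    exact (congrArg Subtype.val (hf hxy)).symm
  have hAD : ∀ x y, A x y → D.Adj x y := by
    rintro x y ⟨hx, rfl⟩
    exact (hfX ⟨x, hx⟩).1
  have hAY : ∀ x y, A x y → y ∈ Y := by
    rintro x y ⟨hx, rfl⟩
    exact (hfX _).2
  have hApred : ∀ p : P, ∀ x, ¬ A x p.1.1 := fun p x h =>
    hYP p p.2 _ (hroot p p.2) (hAY _ _ h)
  choose a O hO hAa using fun p : P => SimplePath.exists_forall_not hAinj p.1.1 (hApred p)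
  have hOY : ∀ p, ∀ x ∈ O p, x = p.1.1 ∨ x ∈ Y := by
    intro p x hx
    rcases ((hO p).reflTransGen x hx).cases_tail with h | ⟨y, -, hy⟩
    · exact Or.inl h
    · exact Or.inr (hAY _ _ hy)
  have hOp : ∀ p : P, ∀ x ∈ p.1.2, x ∈ O p → x = p.1.1 := fun p x hx hxO =>
    (hOY p x hxO).resolve_right (hYP p p.2 x hx)
  -- Arcs of the contracted digraph leave through the exit `a p` and enter the packed branching
  -- itself, never the path `O q`; hence at most `b` entry vertices.
  let D' : Digraph P := ⟨fun p q => p ≠ q ∧ ∃ u ∈ q.1.2, D.Adj (a p) u⟩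
  have hdeg' : ∀ p, s ≤ D'.outDegree p := by
    intro p
    have hfew : {y | D.Adj (a p) y ∧ y ∈ Y}.ncard < d := by
      by_contra! hle
      refine hAa p _ ⟨⟨?_, hle⟩, rfl⟩
      exact (hOY p _ (hO p).right_mem).symm.imp_right fun h => ⟨p, p.2, h.symm⟩
    have hcov : {y | D.Adj (a p) y} ⊆
        {y | D.Adj (a p) y ∧ y ∈ Y} ∪ ⋃ q ∈ insert p {q | D'.Adj p q}, q.1.2 := by
      intro y hy
      by_cases hyY : y ∈ Y
      · exact Or.inl ⟨hy, hyY⟩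
      · simp only [hYdef, Set.mem_ofPred_eq, not_not, Set.mem_iUnion] at hyY
        obtain ⟨q, hq, hyq⟩ := hyY
        refine Or.inr (Set.mem_biUnion (x := (⟨q, hq⟩ : P)) ?_ hyq)
        by_cases hpq : p = ⟨q, hq⟩
        · exact Or.inl hpq.symm
        · exact Or.inr ⟨hpq, y, hyq, hy⟩
    -- The `+ 1` pays for the out-neighbours of `a p` inside the branching of `p` itself, which give
    -- no arc of `D'`.
    have h1 : (⋃ q ∈ insert p {q | D'.Adj p q}, q.1.2).ncard ≤ (D'.outDegree p + 1) * b := by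
      refine ((Set.toFinite _).ncard_biUnion_le _).trans ?_
      rw [finsum_mem_eq_finite_toFinset_sum _ (Set.toFinite _)]
      refine (Finset.sum_le_card_nsmul _ _ b fun q _ => (hP q.1 q.2).1).trans ?_
      rw [smul_eq_mul, ← Set.ncard_eq_toFinset_card]
      exact Nat.mul_le_mul_right _ (Set.ncard_insert_le _ _)
    have h2 := (Set.ncard_le_ncard hcov (Set.toFinite _)).trans (Set.ncard_union_le _ _)
    have h3 : d + (s + 1) * b ≤ {y | D.Adj (a p) y}.ncard := hdeg (a p)
    have h4 : (s + 1) * b ≤ (D'.outDegree p + 1) * b := by omega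
    exact Nat.succ_le_succ_iff.1 (Nat.le_of_mul_le_mul_right h4 hb)
  obtain ⟨y, S, hS⟩ := ih P D' (fun p h => h.1 rfl) (le_minOutDegree hdeg')
  have hdisj : Pairwise fun p q : P => Disjoint (p.1.2 ∪ O p) (q.1.2 ∪ O q) := by
    intro p q hpq
    have hpq' : Disjoint p.1.2 q.1.2 := hPd p.2 q.2 fun h => hpq (Subtype.ext h)
    have hsymm : ∀ p q : P, Disjoint p.1.2 q.1.2 → Disjoint p.1.2 (O q) := by
      intro p q h
      refine Set.disjoint_left.2 fun x hx hxO => ?_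
      rcases hOY q x hxO with rfl | hxY
      · exact Set.disjoint_left.1 h hx (hroot q q.2)
      · exact hYP p p.2 x hx hxY
    refine Set.disjoint_union_left.2 ⟨Set.disjoint_union_right.2 ⟨hpq', hsymm p q hpq'⟩,
      Set.disjoint_union_right.2 ⟨(hsymm q p hpq'.symm).symm, ?_⟩⟩
    refine Set.disjoint_left.2 fun x hx hx' => ?_
    have : p.1.1 = q.1.1 := ((hO p).reflTransGen x hx).eq_of_forall_not hAinj (hApred p)
      (hApred q) ((hO q).reflTransGen x hx')
    exact Set.disjoint_left.1 hpq' (hroot p p.2) (this ▸ hroot q q.2)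
  have hpath : ∀ p : P, ∀ u ∈ p.1.2, ∃ T ⊆ p.1.2 ∪ O p, SimplePath D.Adj u (a p) T := by
    intro p u hu
    obtain ⟨j, -, hj⟩ := (hP p p.2).2
    obtain ⟨T, hT, h⟩ := hj.exists_simplePath u hu
    exact ⟨T ∪ O p, Set.union_subset_union_left _ hT,
      h.trans ((hO p).mono hAD) fun x hx => hOp p x (hT hx.1) hx.2⟩
  have hbase : ∀ p : P, ∃ T ⊆ p.1.2 ∪ O p, D.PlantedBranching ℓ 1 (a p) T := by
    intro p
    obtain ⟨j, hj1, hj⟩ := (hP p p.2).2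
    obtain ⟨T, hT, h⟩ := hj.of_le hj1
    exact ⟨T ∪ O p, Set.union_subset_union_left _ hT,
      h.extend ((hO p).mono hAD) fun x hx => hOp p x (hT hx.1) hx.2⟩
  have hadj : ∀ p q : P, D'.Adj p q → ∃ u ∈ q.1.2, D.Adj (a p) u := fun p q h => h.2
  obtain ⟨T, -, hT⟩ := hS.lift (fun _ => Set.toFinite _) (fun p => (hP p.1 p.2).1) hℓ hdisj hpath
    hbase hadj
  exact ⟨_, T, hT⟩

theorem exists_plantedBranching (k : ℕ) : ∀ {ℓ : ℕ}, 2 ≤ ℓ → ∀ (V : Type u) [Finite V]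
    [Nonempty V] (D : Digraph V), D.Loopless → inBranchingBound (k + 1) ℓ ≤ D.minOutDegree →
    ∃ v S, D.PlantedBranching ℓ (k + 1) v S := by
  induction k with
  | zero =>
    intro ℓ hℓ V _ _ D hD hdeg
    obtain ⟨v, hv⟩ := exists_le_ncard_inNeighbors fun v => hdeg.trans (D.minOutDegree_le v)
    obtain ⟨g, hg, hgv⟩ := Set.exists_injective_fin_of_le_ncard (Set.toFinite _) hv
    refine ⟨v, _, .branch (fun i => .single (g i)) (fun i j hij => ?_) hgv fun i hi => ?_⟩
    · exact Set.disjoint_singleton.2 fun h => hij (hg h)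
    · have h := hgv i
      rw [← Set.mem_singleton_iff.1 hi] at h
      exact hD _ h
  | succ k ih =>
    intro ℓ hℓ V _ _ D hD hdeg
    -- The assumption that no planted branching exists is what allows the packing; the contraction
    -- step then contradicts it.
    by_contra hno
    obtain ⟨P, hP, hPd, hPv⟩ := D.exists_packing hD (ℓ := ℓ) (by omega) (k + 1) Set.univ
      fun r S _ h => hno ⟨r, S, h.1⟩
    refine hno (exists_plantedBranching_of_packing (by omega) (inBranchingCard_pos (k + 1) ℓ)
      (d := (ℓ - 1) * (k + 2)) (Nat.mul_pos (by omega) (by omega)) (P := P) (fun p hp => ?_) hPd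
      (fun v hv => ?_) (fun v => le_trans ?_ (hdeg.trans (D.minOutDegree_le v)))
      (fun W _ _ D' hD' h => ih (by
        have := Nat.mul_pos (inBranchingCard_pos (k + 1) ℓ) (show 0 < ℓ - 1 by omega)
        omega) W D' hD' h))
    · obtain ⟨-, j, h1, hj, h⟩ := hP p hp
      exact ⟨h.2.trans (inBranchingCard_mono hj), j, h1, h.1⟩
    · simpa using hPv v ⟨trivial, hv⟩
    · simp only [inBranchingBound]
      have hs := inBranchingBound_pos k (Nat.succ_pos (inBranchingCard (k + 1) ℓ * (ℓ - 1)))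
      have hb : 2 ≤ inBranchingCard (k + 1) ℓ := by
        rw [inBranchingCard_succ]
        have := Nat.mul_pos (show 0 < ℓ by omega) (inBranchingCard_pos k ℓ)
        omega
      have hc : 2 ≤ (ℓ - 1) * (k + 2) := by
        have := Nat.mul_le_mul (show 1 ≤ ℓ - 1 by omega) (show 2 ≤ k + 2 by omega)
        omega
      generalize inBranchingBound (k + 1) _ = s at hs ⊢
      generalize inBranchingCard (k + 1) ℓ = b at hb ⊢
      rw [mul_assoc (s * b)]
      generalize (ℓ - 1) * (k + 2) = c at hc ⊢
      -- The goal amounts to `c + b ≤ s * b * c`, and `c + b ≤ b * c` because `b` and `c` are at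
      -- least 2.
      have : b * c ≤ s * b * c := Nat.mul_le_mul_right _ (Nat.le_mul_of_pos_left _ hs)
      nlinarith

end Digraph

/-! ### From planted branchings to subdivisions of `B(k, ℓ)`. -/

namespace Digraph

variable {V : Type*} {D : Digraph V} {ℓ : ℕ}

/-- A subdivision of `B(k, ℓ)` in `S` indexed by words, together with a path from its root to `v`.
The arc leaving the word `w` is replaced by a path whose first vertex is `β w` and whose internal
vertices are `ι w`; for the empty word this is the path to `v`. -/
structure WordSubdivision (D : Digraph V) (ℓ k : ℕ) (v : V) (S : Set V)
    (β : List (Fin ℓ) → V) (ι : List (Fin ℓ) → List V) : Prop where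
  mem : ∀ w, w.length ≤ k → ∀ x ∈ β w :: ι w, x ∈ S
  nodup : ∀ w, w.length ≤ k → (β w :: ι w).Nodup
  disjoint : ∀ w w', w.length ≤ k → w'.length ≤ k → w ≠ w' → ∀ x ∈ β w :: ι w, x ∉ β w' :: ι w'
  isChain : ∀ a w, (a :: w).length ≤ k →
    List.IsChain D.Adj (β (a :: w) :: ι (a :: w) ++ [β w])
  isChain_root : List.IsChain D.Adj (β [] :: ι [])
  getLast : (β [] :: ι []).getLast? = some v

theorem PlantedBranching.exists_wordSubdivision {k : ℕ} {v : V} {S : Set V}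
    (h : D.PlantedBranching ℓ k v S) : ∃ β ι, WordSubdivision D ℓ k v S β ι := by
  induction h with
  | single v =>
    refine ⟨fun _ => v, fun _ => [], ⟨by simp, by simp, ?_, by simp, by simp, by simp⟩⟩
    intro w w' hw hw' h
    exact (h ((List.length_eq_zero_iff.1 (by omega)).trans
      (List.length_eq_zero_iff.1 (show w'.length = 0 by omega)).symm)).elim
  | @step k v u S hp ha hn ih =>
    obtain ⟨β, ι, h⟩ := ih
    let ι' := fun w => if w = [] then ι [] ++ [u] else ι w
    have hι : ∀ w, ∀ x ∈ β w :: ι' w, x ∈ β w :: ι w ∨ (w = [] ∧ x = u) := by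
      intro w x hx
      by_cases hw : w = []
      · subst hw
        simpa [ι', or_assoc] using hx
      · simp only [ι', hw, if_false] at hx
        exact Or.inl hx
    refine ⟨β, ι', ⟨?_, ?_, ?_, ?_, ?_, ?_⟩⟩
    · intro w hw x hx
      rcases hι w x hx with hx₁ | ⟨-, rfl⟩
      · exact Or.inr (h.mem w hw x hx₁)
      · exact Or.inl rfl
    · intro w hw
      by_cases hw' : w = []
      · subst hw'
        simp only [ι', if_true, ← List.cons_append]
        refine List.nodup_append'.2 ⟨h.nodup _ hw, by simp, ?_⟩
        exact List.disjoint_singleton.2 fun hu => hn (h.mem _ hw _ hu)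
      · simpa only [ι', hw', if_false] using h.nodup w hw
    · intro w w' hw hw' hne x hx hx'
      rcases hι w x hx with hxw | ⟨rfl, rfl⟩
      · rcases hι w' x hx' with hxw' | ⟨rfl, rfl⟩
        · exact h.disjoint w w' hw hw' hne x hxw hxw'
        · exact hn (h.mem w hw _ hxw)
      · rcases hι w' x hx' with hxw' | ⟨rfl, -⟩
        · exact hn (h.mem w' hw' _ hxw')
        · exact hne rfl
    · intro a w hw
      simpa only [ι', List.cons_ne_nil, if_false] using h.isChain a w hw
    · simp only [ι', if_true, ← List.cons_append]
      refine List.isChain_append.2 ⟨h.isChain_root, by simp, fun x hx y hy => ?_⟩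
      rw [h.getLast] at hx
      simp only [Option.mem_def, Option.some.injEq, List.head?_cons] at hx hy
      exact hx ▸ hy ▸ ha
    · simp only [ι', if_true, ← List.cons_append, List.getLast?_append, List.getLast?_singleton]
      simp
  | @branch k r v S hp hd ha hn ih =>
    choose β ι h using ih
    -- In `inBranching` words grow at the head, so the branch at the root is recorded by the last
    -- letter: the word `w` of the `i`-th branching becomes `w ++ [i]`.
    let β' : List (Fin ℓ) → V := fun w =>
      if hw : w = [] then r else β (w.getLast hw) w.dropLast
    let ι' : List (Fin ℓ) → List V := fun w =>
      if hw : w = [] then [] else ι (w.getLast hw) w.dropLast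
    have hβ0 : β' [] = r := rfl
    have hι0 : ι' [] = [] := rfl
    have hβ : ∀ w i, β' (w ++ [i]) = β i w := by
      intro w i
      simp only [β']
      rw [dif_neg (by simp)]
      simp
    have hι : ∀ w i, ι' (w ++ [i]) = ι i w := by
      intro w i
      simp only [ι']
      rw [dif_neg (by simp)]
      simp
    have hmem : ∀ i w, w.length ≤ k → ∀ x ∈ β i w :: ι i w, x ∈ S i := fun i => (h i).mem
    refine ⟨β', ι', ⟨?_, ?_, ?_, ?_, ?_, ?_⟩⟩
    · intro w hw x hx
      rcases w.eq_nil_or_concat' with rfl | ⟨w, i, rfl⟩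
      · exact Or.inl (by simpa [hβ0, hι0] using hx)
      · rw [hβ, hι] at hx
        exact Or.inr (Set.mem_iUnion.2 ⟨i, hmem i w (by simpa using hw) x hx⟩)
    · intro w hw
      rcases w.eq_nil_or_concat' with rfl | ⟨w, i, rfl⟩
      · simp [hι0]
      · rw [hβ, hι]
        exact (h i).nodup w (by simpa using hw)
    · intro w w' hw hw' hne x hx hx'
      rcases w.eq_nil_or_concat' with rfl | ⟨w, i, rfl⟩
      · rcases w'.eq_nil_or_concat' with rfl | ⟨w', j, rfl⟩
        · exact hne rfl
        · rw [hβ, hι] at hx'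
          have : x = r := by simpa [hβ0, hι0] using hx
          exact hn j (this ▸ hmem j w' (by simpa using hw') x hx')
      · rw [hβ, hι] at hx
        rcases w'.eq_nil_or_concat' with rfl | ⟨w', j, rfl⟩
        · have : x = r := by simpa [hβ0, hι0] using hx'
          exact hn i (this ▸ hmem i w (by simpa using hw) x hx)
        · rw [hβ, hι] at hx'
          have hxS := hmem i w (by simpa using hw) x hx
          by_cases hij : i = j
          · subst hij
            exact (h i).disjoint w w' (by simpa using hw) (by simpa using hw')
              (fun h => hne (by rw [h])) x hx hx'
          · exact Set.disjoint_left.1 (hd hij) hxS (hmem j w' (by simpa using hw') x hx')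
    · intro a w hw
      rcases w.eq_nil_or_concat' with rfl | ⟨w, i, rfl⟩
      · have h1 := hβ [] a
        have h2 := hι [] a
        rw [List.nil_append] at h1 h2
        rw [h1, h2, hβ0]
        refine List.isChain_append.2 ⟨(h a).isChain_root, by simp, fun x hx y hy => ?_⟩
        rw [(h a).getLast] at hx
        simp only [Option.mem_def, Option.some.injEq, List.head?_cons] at hx hy
        exact hx ▸ hy ▸ ha a
      · rw [← List.cons_append, hβ, hι, hβ]
        exact (h i).isChain a w (by simpa using hw)
    · simp [hι0]
    · simp [hβ0, hι0]

theorem PlantedBranching.containsSubdivision {k : ℕ} {v : V} {S : Set V}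
    (h : D.PlantedBranching ℓ k v S) : D.ContainsSubdivision (inBranching k ℓ) := by
  obtain ⟨β, ι, h⟩ := h.exists_wordSubdivision
  refine ⟨⟨fun w => β w.1, fun w _ => ι w.1, ?_, ?_, ?_, ?_, ?_⟩⟩
  · intro w w' hww
    by_contra hne
    exact h.disjoint w.1 w'.1 w.2 w'.2 (fun h => hne (Subtype.ext h)) (β w.1) (by simp)
      (by simp only at hww; simp [hww])
  · rintro ⟨_, hu⟩ w ⟨a, rfl⟩
    exact h.isChain a w.1 hu
  · intro u _ _
    exact (h.nodup u.1 u.2).of_cons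
  · intro u _ _ w hw
    by_cases huw : u = w
    · subst huw
      exact (List.nodup_cons.1 (h.nodup u.1 u.2)).1 hw
    · exact h.disjoint u.1 w.1 u.2 w.2 (fun h => huw (Subtype.ext h)) (β w.1)
        (List.mem_cons_of_mem _ hw) (by simp)
  · rintro u w u' w' ⟨a, ha⟩ ⟨a', ha'⟩ hne x hx hx'
    -- An arc of `B(k, ℓ)` is determined by its tail, so different arcs have different tails.
    refine h.disjoint u.1 u'.1 u.2 u'.2 (fun huu => hne ?_) x (List.mem_cons_of_mem _ hx)
      (List.mem_cons_of_mem _ hx')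
    have hw : w.1 = w'.1 := (List.cons.inj (ha.symm.trans (huu.trans ha'))).2
    rw [Subtype.ext huu, Subtype.ext hw]

/-! ### Embedding in-arborescences in `B(k, ℓ)`. -/

theorem ContainsSubdivision.of_injective {U W : Type*} {F : Digraph U} {G : Digraph W}
    (h : D.ContainsSubdivision G) (φ : U → W) (hφ : Function.Injective φ)
    (hadj : ∀ u v, F.Adj u v → G.Adj (φ u) (φ v)) : D.ContainsSubdivision F := by
  obtain ⟨σ⟩ := h
  refine ⟨⟨σ.branch ∘ φ, fun u v => σ.interior (φ u) (φ v), σ.branch_injective.comp hφ,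
    fun u v h => σ.isChain _ _ (hadj u v h), fun u v h => σ.nodup _ _ (hadj u v h),
    fun u v h w => σ.branch_notMem _ _ (hadj u v h) _, fun u v u' v' h h' hne => ?_⟩⟩
  refine σ.disjoint _ _ _ _ (hadj u v h) (hadj u' v' h') fun heq => hne ?_
  rw [Prod.mk.injEq] at heq ⊢
  exact ⟨hφ heq.1, hφ heq.2⟩

/-- In a tree, every vertex has at most one neighbour that is closer to a given vertex. -/
theorem _root_.SimpleGraph.IsTree.eq_of_adj_of_dist_lt {G : SimpleGraph V} (hG : G.IsTree)
    {r u v w : V} (huv : G.Adj u v) (huw : G.Adj u w) (hv : G.dist v r < G.dist u r)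
    (hw : G.dist w r < G.dist u r) : v = w := by
  have key : ∀ x, G.Adj u x → G.dist x r < G.dist u r →
      ∃ p : G.Walk u r, p.IsPath ∧ p.getVert 1 = x := by
    intro x hux hx
    obtain ⟨p, hp⟩ := hG.1.exists_walk_length_eq_dist x r
    refine ⟨.cons hux p, SimpleGraph.Walk.isPath_of_length_eq_dist _ ?_, by simp⟩
    have := SimpleGraph.dist_le (SimpleGraph.Walk.cons hux p)
    rw [SimpleGraph.Walk.length_cons] at this ⊢
    omega
  obtain ⟨p, hp, rfl⟩ := key v huv hv
  obtain ⟨q, hq, rfl⟩ := key w huw hw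
  rw [(hG.existsUnique_path u r).unique hp hq]

/-- Give each vertex its own letter and send `u` to the word of letters read along the path from `u`
to the root, the root itself omitted. The first letter identifies `u`, and following an arc deletes
it. -/
theorem IsInArborescence.exists_embedding {U : Type*} [Finite U] {T : Digraph U}
    (hT : T.IsInArborescence) : ∃ k ℓ, 1 ≤ k ∧ 2 ≤ ℓ ∧ ∃ φ : U → InBranchingVertex k ℓ,
      Function.Injective φ ∧ ∀ u v, T.Adj u v → (inBranching k ℓ).Adj (φ u) (φ v) := by
  classical
  obtain ⟨⟨-, hG⟩, r, hr⟩ := hT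
  set G := T.toSimpleGraphInclusive
  have hAdj : ∀ u v, G.Adj u v ↔ u ≠ v ∧ (T.Adj u v ∨ T.Adj v u) := fun u v =>
    SimpleGraph.fromRel_adj _ _ _
  have hTG : ∀ u v, T.Adj u v → G.Adj u v := fun u v h =>
    (hAdj u v).2 ⟨fun huv => (hr u v h).ne (by rw [huv]), Or.inl h⟩
  have huniq : ∀ u v w, T.Adj u v → T.Adj u w → v = w := fun u v w hv hw =>
    hG.eq_of_adj_of_dist_lt (hTG _ _ hv) (hTG _ _ hw) (hr _ _ hv) (hr _ _ hw)
  have hout : ∀ u, u ≠ r → ∃ v, T.Adj u v := by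
    intro u hu
    obtain ⟨p, hp⟩ := hG.1.exists_walk_length_eq_dist u r
    cases p with
    | nil => exact (hu rfl).elim
    | @cons _ v _ h p =>
      refine ⟨v, ((hAdj u v).1 h).2.resolve_right fun hvu => ?_⟩
      have h1 := hr v u hvu
      have h2 := SimpleGraph.dist_le p
      rw [SimpleGraph.Walk.length_cons] at hp
      omega
  obtain ⟨K, hK⟩ := (Set.finite_range fun u => G.dist u r).bddAbove
  obtain ⟨n, ⟨e⟩⟩ := Finite.exists_equiv_fin U
  -- Two spare letters guarantee an alphabet of size at least 2; likewise the depth is taken as `K +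
  -- 1` below to be positive.
  let ε : U → Fin (n + 2) := fun u => (e u).castAdd 2
  have hε : Function.Injective ε := (Fin.castAdd_injective _ _).comp e.injective
  -- The number `m` bounds the recursion along out-arcs; `W` is used with `m` equal to the distance
  -- to the root, where it reads the whole path.
  let W : ℕ → U → List (Fin (n + 2)) := fun m => Nat.rec (fun _ => [])
    (fun _ ih u => if h : ∃ v, T.Adj u v then ε u :: ih h.choose else []) m
  have hWsucc : ∀ m u v, T.Adj u v → W (m + 1) u = ε u :: W m v := by
    intro m u v h
    have hex : ∃ v, T.Adj u v := ⟨v, h⟩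
    change (if h : ∃ v, T.Adj u v then ε u :: W m h.choose else []) = _
    rw [dif_pos hex, huniq u _ v hex.choose_spec h]
  have hlen : ∀ m u, (W m u).length ≤ m := by
    intro m
    induction m with
    | zero => intro u; exact le_rfl
    | succ m ih =>
      intro u
      by_cases h : ∃ v, T.Adj u v
      · obtain ⟨v, h⟩ := h
        rw [hWsucc m u v h]
        exact Nat.succ_le_succ (ih v)
      · change (if h : ∃ v, T.Adj u v then ε u :: W m h.choose else []).length ≤ _
        rw [dif_neg h]
        exact Nat.zero_le _
  have hcons : ∀ u v, T.Adj u v → W (G.dist u r) u = ε u :: W (G.dist v r) v := by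
    intro u v h
    have h1 := hr u v h
    have h2 := hG.1.dist_triangle (u := u) (v := v) (w := r)
    rw [SimpleGraph.dist_eq_one_iff_adj.2 (hTG u v h)] at h2
    rw [show G.dist u r = G.dist v r + 1 by omega, hWsucc _ u v h]
  have hroot : W (G.dist r r) r = [] := by
    rw [SimpleGraph.dist_self]
    rfl
  refine ⟨K + 1, n + 2, by omega, by omega,
    fun u => ⟨W (G.dist u r) u, (hlen _ u).trans ((hK ⟨u, rfl⟩).trans (Nat.le_succ K))⟩, ?_, ?_⟩
  · intro u u' h
    have h : W (G.dist u r) u = W (G.dist u' r) u' := congrArg Subtype.val h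
    by_cases hu : u = r
    · by_cases hu' : u' = r
      · rw [hu, hu']
      · obtain ⟨v', hv'⟩ := hout u' hu'
        rw [hu, hroot, hcons u' v' hv'] at h
        exact absurd h.symm (List.cons_ne_nil _ _)
    · obtain ⟨v, hv⟩ := hout u hu
      rw [hcons u v hv] at h
      by_cases hu' : u' = r
      · rw [hu', hroot] at h
        exact absurd h (List.cons_ne_nil _ _)
      · obtain ⟨v', hv'⟩ := hout u' hu'
        rw [hcons u' v' hv'] at h
        exact hε (List.cons.inj h).1
  · intro u v h
    exact ⟨ε u, hcons u v h⟩

end Digraph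

theorem mainTheorem2 :
    (∀ k ℓ : ℕ, 1 ≤ k → 2 ≤ ℓ →
      ∀ (V : Type u) [Finite V] [Nonempty V] (D : Digraph V), D.Loopless →
        inBranchingBound k ℓ ≤ D.minOutDegree →
          D.ContainsSubdivision (inBranching k ℓ)) ∧
    (∀ (U : Type v) [Finite U] (T : Digraph U), T.IsInArborescence →
      Digraph.IsOutMaderian.{u, v} T) := by
  have main : ∀ k ℓ : ℕ, 1 ≤ k → 2 ≤ ℓ →
      ∀ (V : Type u) [Finite V] [Nonempty V] (D : Digraph V), D.Loopless →
        inBranchingBound k ℓ ≤ D.minOutDegree →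
          D.ContainsSubdivision (inBranching k ℓ) := by
    intro k ℓ hk hℓ V _ _ D hD hdeg
    obtain ⟨k, rfl⟩ := Nat.exists_eq_add_of_le' hk
    obtain ⟨v, S, h⟩ := Digraph.exists_plantedBranching k hℓ V D hD hdeg
    exact h.containsSubdivision
  refine ⟨main, fun U _ T hT => ?_⟩
  obtain ⟨k, ℓ, hk, hℓ, φ, hφ, hadj⟩ := hT.exists_embedding
  refine ⟨sInf _, Nat.sInf_mem ⟨inBranchingBound k ℓ, ?_⟩, fun m hm => Nat.sInf_le hm⟩
  intro V _ _ D hD hdeg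
  exact (main k ℓ hk hℓ V D hD hdeg).of_injective φ hφ hadj
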